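/- Let $X_1,X_2,\dots$ be i.i.d. real random variables with distribution function $F$, where $F(t)=0$ for $t<0$, $F$ is continuous, and the first and second derivatives $f=F'$ and $f'=F''$ of $F$ exist on $[0,\infty)$ (one-sided at $0$) and are continuous and bounded on $[0,\infty)$. For $m,n\in\mathbb N=\{1,2,\dots\}$ and $x\ge 0$ let $$F_n(t)=\frac1n\sum_{i=1}^n \mathbb 1(X_i\le t),\qquad \hat F^S_{m,n}(x)=\sum_{k=0}^\infty F_n\!\left(\frac km\right)e^{-mx}\frac{(mx)^k}{k!}$$ be the empirical distribution function and the Szasz estimator, and let $$\mathrm{MSE}\big[\hat F^S_{m,n}(x)\big]=\mathbb E\Big[\big(\hat F^S_{m,n}(x)-F(x)\big)^2\Big],\qquad \mathrm{Bias}\big[\hat F^S_{m,n}(x)\big]=\mathbb E\big[\hat F^S_{m,n}(x)\big]-F(x).$$ Put $\sigma^2(x)=F(x)(1-F(x))$, $V^S(x)=f(x)\,(x/\pi)^{1/2}$ and $b^S(x)=\tfrac12 x f'(x)$. Then, for every $x\in(0,\infty)$, the random variables $\hat F^S_{m,n}(x)$ are square integrable and $$\mathrm{MSE}\big[\hat F^S_{m,n}(x)\big]=\mathrm{Var}\big[\hat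 F^S_{m,n}(x)\big]+\mathrm{Bias}\big[\hat F^S_{m,n}(x)\big]^2$$ $$=n^{-1}\sigma^2(x)-m^{-1/2}n^{-1}V^S(x)+m^{-2}\big(b^S(x)\big)^2+o_x(m^{-2})+o_x(m^{-1/2}n^{-1}),$$ where $u_{m,n}=o_x(v_{m,n})$ means that $u_{m,n}/v_{m,n}\to 0$ as $m,n\to\infty$ jointly (without any relation between $m$ and $n$), for fixed $x$, at a rate that may depend on $x$. -/

import Mathlib

open MeasureTheory ProbabilityTheory Filter Asymptotics
open scoped Topology

noncomputable section

/-- The Poisson weights `V_{k,m}(x) = e^{-mx} (mx)^k / k!`. -/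
def szaszWeight (k m : ℕ) (x : ℝ) : ℝ :=
  Real.exp (-((m : ℝ) * x)) * ((m : ℝ) * x) ^ k / (Nat.factorial k : ℝ)

/-- The empirical distribution function `F_n(t) = n⁻¹ ∑_{i=1}^n 𝟙(X_i ≤ t)` of the first `n`
members `X 0, …, X (n - 1)` of the sample, evaluated at the outcome `ω`. -/
def empiricalCDF {Ω : Type*} (X : ℕ → Ω → ℝ) (n : ℕ) (t : ℝ) (ω : Ω) : ℝ :=
  (n : ℝ)⁻¹ * ∑ i ∈ Finset.range n, Set.indicator {ω' | X i ω' ≤ t} (fun _ => (1 : ℝ)) ω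

/-- The Szasz estimator `∑_{k=0}^∞ F_n(k/m) V_{k,m}(x)` at the outcome `ω`. -/
def szaszEstimator {Ω : Type*} (X : ℕ → Ω → ℝ) (m n : ℕ) (x : ℝ) (ω : Ω) : ℝ :=
  ∑' k : ℕ, empiricalCDF X n ((k : ℝ) / (m : ℝ)) ω * szaszWeight k m x

/-- Mean-squared error `E[(T - θ)²]` of an estimator `T` of the real number `θ`. -/
def meanSquaredError {Ω : Type*} [MeasurableSpace Ω] (P : Measure Ω) (T : Ω → ℝ) (θ : ℝ) : ℝ :=
  ∫ ω, (T ω - θ) ^ 2 ∂P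

/-- Bias `E[T] - θ` of an estimator `T` of the real number `θ`. -/
def estimatorBias {Ω : Type*} [MeasurableSpace Ω] (P : Measure Ω) (T : Ω → ℝ) (θ : ℝ) : ℝ :=
  (∫ ω, T ω ∂P) - θ

/-- `F` is continuous, vanishes on the negative half line, and on `[0, ∞)` has first and second
derivatives `f` and `df` (one-sided at `0`), which are continuous and bounded on `[0, ∞)`. -/
structure SmoothHalfLineCDF (F f df : ℝ → ℝ) : Prop where
  continuous : Continuous F
  eq_zero_of_neg : ∀ t : ℝ, t < 0 → F t = 0
  hasDeriv : ∀ t ∈ Set.Ici (0 : ℝ), HasDerivWithinAt F (f t) (Set.Ici 0) t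
  hasSecondDeriv : ∀ t ∈ Set.Ici (0 : ℝ), HasDerivWithinAt f (df t) (Set.Ici 0) t
  continuousOn_deriv : ContinuousOn f (Set.Ici 0)
  continuousOn_secondDeriv : ContinuousOn df (Set.Ici 0)
  bounded_deriv : ∃ C : ℝ, ∀ t ∈ Set.Ici (0 : ℝ), |f t| ≤ C
  bounded_secondDeriv : ∃ C : ℝ, ∀ t ∈ Set.Ici (0 : ℝ), |df t| ≤ C

/-- `σ²(x) = F(x) (1 - F(x))`. -/
def sigmaSq (F : ℝ → ℝ) (x : ℝ) : ℝ := F x * (1 - F x)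

/-- `V^S(x) = f(x) (x/π)^{1/2}`. -/
def szaszV (f : ℝ → ℝ) (x : ℝ) : ℝ := f x * Real.sqrt (x / Real.pi)

/-- `b^S(x) = x f'(x) / 2`, where `df` is `f'`. -/
def szaszB (df : ℝ → ℝ) (x : ℝ) : ℝ := x * df x / 2

end

/-! ### Moments of the Poisson distribution -/

section PoissonMoments

open scoped NNReal Nat

variable {r : ℝ≥0}

/-! The weights are the masses of a Poisson variable `K` of mean `mx`, so the estimator is the
empirical mean of i.i.d. variables `szaszSmoothing m x (X i)` bounded by 1. Each has mean `S m = E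
F(K/m)` and, with `L` an independent copy of `K`, second moment `Q m = E F(min(K,L)/m)`. Hence the
bias is `S m - F x`, the variance is `(Q m - S m ^ 2) / n`, and only the asymptotics of `S` and `Q`
in `m` remain.

For `S`, expand `F` to second order at `x`: the linear term has mean zero, the quadratic one gives
`b/m`, and the fourth moment controls the remainder (`tendsto_mul_integral_szaszRate_sub`).

For `Q`, the linear term survives, since `E[min(K,L)/m - x] = -E|K-L|/(2m)`. With `r = mx`, `E|K-L|
~ 2√(r/π)`, which yields `-V/√m` (`tendsto_sqrt_mul_integral_min_szaszRate_sub`). This asymptotic is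
obtained without a central limit theorem: Stein's identity and Fourier inversion turn `E|K-L|` into
an exact integral over `[-π, π]` (`integral_abs_sub_poissonMeasure`), to which Laplace's method
applies. -/

lemma integrable_natCast_mul_poissonMeasure {g : ℕ → ℝ}
    (hg : Integrable (fun k => g (k + 1)) (poissonMeasure r)) :
    Integrable (fun k : ℕ => (k : ℝ) * g k) (poissonMeasure r) := by
  rw [integrable_poissonMeasure_iff] at hg ⊢
  rw [← summable_nat_add_iff 1]
  refine (hg.mul_left (r : ℝ)).congr fun k => ?_
  have hk : ((k : ℝ) + 1) ≠ 0 := by positivity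
  have hk' : (k ! : ℝ) ≠ 0 := by positivity
  rw [norm_mul, Nat.factorial_succ, Real.norm_natCast]
  simp only [Nat.cast_mul, Nat.cast_add, Nat.cast_one]
  field_simp
  ring

/-- The Stein identity of the Poisson distribution: `E[K g(K)] = r E[g(K + 1)]`. -/
lemma integral_natCast_mul_poissonMeasure {g : ℕ → ℝ}
    (hg : Integrable (fun k => g (k + 1)) (poissonMeasure r)) :
    ∫ k, (k : ℝ) * g k ∂(poissonMeasure r) = r * ∫ k, g (k + 1) ∂(poissonMeasure r) := by
  have h := (hasSum_integral_poissonMeasure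
    (integrable_natCast_mul_poissonMeasure hg)).summable.tsum_eq_zero_add
  rw [integral_poissonMeasure, h, integral_poissonMeasure, ← tsum_mul_left]
  simp only [CharP.cast_eq_zero, zero_mul, mul_zero, zero_add, smul_eq_mul]
  congr 1 with k
  have hk : ((k : ℝ) + 1) ≠ 0 := by positivity
  have hk' : (k ! : ℝ) ≠ 0 := by positivity
  rw [Nat.factorial_succ]
  simp only [Nat.cast_mul, Nat.cast_add, Nat.cast_one]
  field_simp
  ring

/-- Induction on `p` through `(k+c)^(p+1) = k (k+c)^p + c (k+c)^p`. The offset `c` is general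
because the Stein shift replaces it by `1 + c`. -/
lemma integrable_add_pow_poissonMeasure (r : ℝ≥0) (p : ℕ) (c : ℝ) :
    Integrable (fun k : ℕ => ((k : ℝ) + c) ^ p) (poissonMeasure r) := by
  induction p generalizing c with
  | zero => simp
  | succ p ih =>
    have h1 : Integrable (fun k : ℕ => (k : ℝ) * ((k : ℝ) + c) ^ p) (poissonMeasure r) := by
      apply integrable_natCast_mul_poissonMeasure (g := fun k => ((k : ℝ) + c) ^ p)
      simpa [add_assoc] using ih (1 + c)
    refine (h1.add ((ih c).const_mul c)).congr (ae_of_all _ fun k => ?_)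
    simp only [Pi.add_apply]
    ring

lemma integrable_pow_poissonMeasure (r : ℝ≥0) (p : ℕ) :
    Integrable (fun k : ℕ => (k : ℝ) ^ p) (poissonMeasure r) := by
  simpa using integrable_add_pow_poissonMeasure r p 0

lemma integrable_natCast_poissonMeasure (r : ℝ≥0) :
    Integrable (fun k : ℕ => (k : ℝ)) (poissonMeasure r) := by
  simpa using integrable_pow_poissonMeasure r 1

lemma integral_natCast_poissonMeasure (r : ℝ≥0) :
    ∫ k : ℕ, (k : ℝ) ∂(poissonMeasure r) = r := by
  simpa using integral_natCast_mul_poissonMeasure (r := r) (g := fun _ => 1) (by simp)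

/-- Stein's identity lowers the degree by one, so the raw moments follow one after another. -/
lemma integral_pow_succ_poissonMeasure (r : ℝ≥0) (p : ℕ) :
    ∫ k : ℕ, (k : ℝ) ^ (p + 1) ∂(poissonMeasure r)
      = r * ∫ k : ℕ, ((k : ℝ) + 1) ^ p ∂(poissonMeasure r) := by
  have := integral_natCast_mul_poissonMeasure (r := r) (g := fun k => (k : ℝ) ^ p)
    (by simpa using integrable_add_pow_poissonMeasure r p 1)
  simpa [pow_succ'] using this

lemma integral_sq_poissonMeasure (r : ℝ≥0) :
    ∫ k : ℕ, (k : ℝ) ^ 2 ∂(poissonMeasure r) = r ^ 2 + r := by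
  rw [integral_pow_succ_poissonMeasure]
  simp only [pow_one]
  rw [integral_add (integrable_natCast_poissonMeasure r) (integrable_const _),
    integral_natCast_poissonMeasure]
  simp
  ring

lemma integral_pow_three_poissonMeasure (r : ℝ≥0) :
    ∫ k : ℕ, (k : ℝ) ^ 3 ∂(poissonMeasure r) = r ^ 3 + 3 * r ^ 2 + r := by
  rw [integral_pow_succ_poissonMeasure]
  have e : ∀ k : ℕ, ((k : ℝ) + 1) ^ 2 = (k : ℝ) ^ 2 + 2 * k + 1 := fun k => by ring
  have h1 := integrable_natCast_poissonMeasure r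
  have h2 := integrable_pow_poissonMeasure r 2
  simp_rw [e]
  rw [integral_add (by fun_prop) (by fun_prop), integral_add (by fun_prop) (by fun_prop),
    integral_const_mul, integral_natCast_poissonMeasure, integral_sq_poissonMeasure]
  simp
  ring

lemma integral_pow_four_poissonMeasure (r : ℝ≥0) :
    ∫ k : ℕ, (k : ℝ) ^ 4 ∂(poissonMeasure r) = r ^ 4 + 6 * r ^ 3 + 7 * r ^ 2 + r := by
  rw [integral_pow_succ_poissonMeasure]
  have e : ∀ k : ℕ, ((k : ℝ) + 1) ^ 3 = (k : ℝ) ^ 3 + 3 * (k : ℝ) ^ 2 + 3 * k + 1 :=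
    fun k => by ring
  have h1 := integrable_natCast_poissonMeasure r
  have h2 := integrable_pow_poissonMeasure r 2
  have h3 := integrable_pow_poissonMeasure r 3
  simp_rw [e]
  rw [integral_add (by fun_prop) (by fun_prop), integral_add (by fun_prop) (by fun_prop),
    integral_add (by fun_prop) (by fun_prop),
    integral_const_mul, integral_const_mul, integral_natCast_poissonMeasure,
    integral_sq_poissonMeasure, integral_pow_three_poissonMeasure]
  simp
  ring

lemma integral_sub_sq_poissonMeasure (r : ℝ≥0) :
    ∫ k : ℕ, ((k : ℝ) - r) ^ 2 ∂(poissonMeasure r) = r := by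
  have e : ∀ k : ℕ, ((k : ℝ) - r) ^ 2 = (k : ℝ) ^ 2 - (2 * r) * k + (r : ℝ) ^ 2 :=
    fun k => by ring
  have h1 := integrable_natCast_poissonMeasure r
  have h2 := integrable_pow_poissonMeasure r 2
  simp_rw [e]
  rw [integral_add (by fun_prop) (by fun_prop), integral_sub (by fun_prop) (by fun_prop),
    integral_const_mul, integral_natCast_poissonMeasure, integral_sq_poissonMeasure]
  simp
  ring

lemma integral_sub_pow_four_poissonMeasure (r : ℝ≥0) :
    ∫ k : ℕ, ((k : ℝ) - r) ^ 4 ∂(poissonMeasure r) = 3 * r ^ 2 + r := by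
  have e : ∀ k : ℕ, ((k : ℝ) - r) ^ 4 = (k : ℝ) ^ 4 - (4 * r) * (k : ℝ) ^ 3
      + (6 * (r : ℝ) ^ 2) * (k : ℝ) ^ 2 - (4 * (r : ℝ) ^ 3) * k + (r : ℝ) ^ 4 :=
    fun k => by ring
  have h1 := integrable_natCast_poissonMeasure r
  have h2 := integrable_pow_poissonMeasure r 2
  have h3 := integrable_pow_poissonMeasure r 3
  have h4 := integrable_pow_poissonMeasure r 4
  simp_rw [e]
  rw [integral_add (by fun_prop) (by fun_prop), integral_sub (by fun_prop) (by fun_prop),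
    integral_add (by fun_prop) (by fun_prop), integral_sub (by fun_prop) (by fun_prop),
    integral_const_mul, integral_const_mul, integral_const_mul, integral_natCast_poissonMeasure,
    integral_sq_poissonMeasure, integral_pow_three_poissonMeasure,
    integral_pow_four_poissonMeasure]
  simp
  ring

end PoissonMoments

/-! ### Fourier kernel and Laplace asymptotics -/

section PoissonAbsDiff

open scoped NNReal Real

lemma integral_cos_intCast_mul (d : ℤ) :
    ∫ t in (-π)..π, Real.cos (d * t) = if d = 0 then 2 * π else 0 := by
  split_ifs with h
  · simp [h]; ring
  · have hd : (d : ℝ) ≠ 0 := by exact_mod_cast h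
    rw [intervalIntegral.integral_comp_mul_left (fun t => Real.cos t) hd, integral_cos]
    simp [Real.sin_int_mul_pi]

/-- By product-to-sum and orthogonality only `d = -1, 0, 1` survive, with values `π, 2π, π`. The
sign difference is the form in which this kernel arises from `|K - L|`. -/
lemma integral_one_add_cos_mul_cos (d : ℤ) :
    ∫ t in (-π)..π, (1 + Real.cos t) * Real.cos (d * t)
      = π * (((d + 1).sign - (d - 1).sign : ℤ) : ℝ) := by
  have e : ∀ t : ℝ, (1 + Real.cos t) * Real.cos (d * t) = Real.cos (d * t)
      + (1 / 2) * Real.cos ((d + 1 : ℤ) * t) + (1 / 2) * Real.cos ((d - 1 : ℤ) * t) := by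
    intro t
    push_cast
    rw [add_mul, add_mul, sub_mul, one_mul, one_mul, Real.cos_add, Real.cos_sub]
    ring
  have hc : ∀ j : ℤ, IntervalIntegrable (fun t : ℝ => Real.cos (j * t)) volume (-π) π :=
    fun j => by apply Continuous.intervalIntegrable; fun_prop
  simp_rw [e]
  rw [intervalIntegral.integral_add ((hc _).add ((hc _).const_mul _)) ((hc _).const_mul _),
    intervalIntegral.integral_add (hc _) ((hc _).const_mul _),
    intervalIntegral.integral_const_mul, intervalIntegral.integral_const_mul,
    integral_cos_intCast_mul, integral_cos_intCast_mul, integral_cos_intCast_mul]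
  obtain h | rfl | rfl | rfl | h : d < -1 ∨ d = -1 ∨ d = 0 ∨ d = 1 ∨ 1 < d := by omega
  · rw [Int.sign_eq_neg_one_of_neg (by omega : d + 1 < 0),
      Int.sign_eq_neg_one_of_neg (by omega : d - 1 < 0)]
    rw [if_neg (by omega), if_neg (by omega), if_neg (by omega)]
    simp
  · norm_num [show Int.sign 2 = 1 from rfl]; ring
  · norm_num; ring
  · norm_num [show Int.sign 2 = 1 from rfl]; ring
  · rw [Int.sign_eq_one_of_pos (by omega : 0 < d + 1), Int.sign_eq_one_of_pos (by omega : 0 < d - 1)]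
    rw [if_neg (by omega), if_neg (by omega), if_neg (by omega)]
    simp

/-- Laplace's method at `t = 0`: after `u = √r t` the exponent tends to `-u²` and the prefactor to
`2`, leaving a Gaussian integral. -/
lemma tendsto_sqrt_mul_integral_one_add_cos_mul_exp :
    Tendsto (fun r : ℝ => √r * ∫ t in (-π)..π, (1 + Real.cos t) * Real.exp (2 * r * (Real.cos t - 1)))
      atTop (𝓝 (2 * √π)) := by
  -- The rescaled integrand, cut off by an indicator so that dominated convergence runs over a fixed
  -- domain.
  let G : ℝ → ℝ → ℝ := fun r u => (Set.Ioc (-π * √r) (π * √r)).indicator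
    (fun u => (1 + Real.cos (u / √r)) * Real.exp (2 * r * (Real.cos (u / √r) - 1))) u
  have hG : ∀ᶠ r : ℝ in atTop, ∫ u, G r u = √r * ∫ t in (-π)..π,
      (1 + Real.cos t) * Real.exp (2 * r * (Real.cos t - 1)) := by
    filter_upwards [eventually_gt_atTop 0] with r hr
    have hs : 0 < √r := Real.sqrt_pos.2 hr
    have hle : -π * √r ≤ π * √r := by nlinarith [Real.pi_pos]
    simp only [G]
    rw [integral_indicator measurableSet_Ioc, ← intervalIntegral.integral_of_le hle,
      intervalIntegral.integral_comp_div
        (fun t => (1 + Real.cos t) * Real.exp (2 * r * (Real.cos t - 1))) hs.ne',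
      mul_div_cancel_right₀ _ hs.ne', mul_div_cancel_right₀ _ hs.ne', smul_eq_mul]
  have hlim : ∫ u : ℝ, 2 * Real.exp (-1 * u ^ 2) = 2 * √π := by
    rw [integral_const_mul, integral_gaussian]; simp
  rw [← hlim]
  refine Tendsto.congr' hG ?_
  refine tendsto_integral_filter_of_dominated_convergence
    (fun u => 2 * Real.exp (-(4 / π ^ 2) * u ^ 2)) ?_ ?_ ?_ ?_
  · refine Eventually.of_forall fun r => ?_
    refine (Measurable.indicator ?_ measurableSet_Ioc).aestronglyMeasurable
    fun_prop
  · filter_upwards [eventually_gt_atTop 0] with r hr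
    refine ae_of_all _ fun u => ?_
    have hs : 0 < √r := Real.sqrt_pos.2 hr
    simp only [G]
    by_cases hu : u ∈ Set.Ioc (-π * √r) (π * √r)
    · rw [Set.indicator_of_mem hu, norm_mul, Real.norm_eq_abs, Real.norm_eq_abs, Real.abs_exp]
      have h1 : |1 + Real.cos (u / √r)| ≤ 2 := by
        rw [abs_le]
        constructor <;> linarith [Real.neg_one_le_cos (u / √r), Real.cos_le_one (u / √r)]
      have h2 : |u / √r| ≤ π := by
        rw [abs_div, abs_of_pos hs, div_le_iff₀ hs, abs_le]
        exact ⟨by linarith [hu.1], hu.2⟩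
      -- The bound `cos t ≤ 1 - 2t²/π²` on `[-π, π]` supplies the dominating Gaussian.
      have h3 := Real.cos_le_one_sub_mul_cos_sq h2
      have h4 : 2 * r * (Real.cos (u / √r) - 1) ≤ -(4 / π ^ 2) * u ^ 2 := by
        calc 2 * r * (Real.cos (u / √r) - 1)
            ≤ 2 * r * (-(2 / π ^ 2 * (u / √r) ^ 2)) := by
              apply mul_le_mul_of_nonneg_left _ (by positivity)
              linarith
          _ = _ := by
              rw [div_pow, Real.sq_sqrt hr.le]
              field_simp
              ring
      gcongr
    · rw [Set.indicator_of_notMem hu, norm_zero]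
      positivity
  · apply Integrable.const_mul
    apply integrable_exp_neg_mul_sq
    positivity
  · refine ae_of_all _ fun u => ?_
    have hsq : Tendsto (fun r : ℝ => √r) atTop atTop := Real.tendsto_sqrt_atTop
    have hdiv : Tendsto (fun r : ℝ => u / √r) atTop (𝓝 0) := hsq.const_div_atTop u
    have hcos : Tendsto (fun r : ℝ => Real.cos (u / √r)) atTop (𝓝 1) := by
      simpa [Function.comp_def] using (Real.continuous_cos.tendsto 0).comp hdiv
    have hexp : Tendsto (fun r : ℝ => 2 * r * (Real.cos (u / √r) - 1)) atTop (𝓝 (-1 * u ^ 2)) := by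
      -- By the half-angle formula the exponent equals `-u² sinc²(u/(2√r))`.
      have hsinc : Tendsto (fun r : ℝ => Real.sinc (u / √r / 2)) atTop (𝓝 1) := by
        have := (Real.continuous_sinc.tendsto 0).comp (by simpa using hdiv.div_const 2)
        simpa [Function.comp_def] using this
      have h := (hsinc.pow 2).const_mul (-1 * u ^ 2)
      simp only [one_pow, mul_one] at h
      refine h.congr' ?_
      filter_upwards [eventually_gt_atTop 0] with r hr
      have hs : 0 < √r := Real.sqrt_pos.2 hr
      have h2 : Real.cos (u / √r) - 1 = -2 * Real.sin (u / √r / 2) ^ 2 := by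
        rw [Real.sin_sq_eq_half_sub]
        ring_nf
      rw [h2]
      by_cases hu : u = 0
      · simp [hu]
      · rw [Real.sinc_of_ne_zero (by positivity)]
        have : r = √r ^ 2 := (Real.sq_sqrt hr.le).symm
        nth_rewrite 3 [this]
        field_simp
    have h := ((hcos.const_add 1).mul ((Real.continuous_exp.tendsto _).comp hexp))
    norm_num at h
    have h' : (2 : ℝ) * Real.exp (-1 * u ^ 2) = 2 * Real.exp (-u ^ 2) := by norm_num
    rw [h']
    refine h.congr' ?_
    filter_upwards [(hsq.const_mul_atTop Real.pi_pos).eventually_gt_atTop |u|] with r hr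
    simp only [G]
    have hu : u ∈ Set.Ioc (-π * √r) (π * √r) :=
      ⟨by linarith [(abs_lt.1 hr).1], (abs_lt.1 hr).2.le⟩
    rw [Set.indicator_of_mem hu]

end PoissonAbsDiff

/-! ### Mean absolute difference of two independent Poisson variables -/

section PoissonAbsDiffMean

open scoped NNReal Real

variable {r : ℝ≥0}

lemma integrable_of_forall_abs_le {α : Type*} [MeasurableSpace α] [DiscreteMeasurableSpace α]
    {μ : Measure α} [IsFiniteMeasure μ] {G : α → ℝ} {C : ℝ} (hG : ∀ a, |G a| ≤ C) :
    Integrable G μ :=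
  Integrable.of_bound Measurable.of_discrete.aestronglyMeasurable C (ae_of_all _ hG)

lemma integrable_fst_poissonMeasure_prod (r : ℝ≥0) :
    Integrable (fun p : ℕ × ℕ => (p.1 : ℝ)) ((poissonMeasure r).prod (poissonMeasure r)) :=
  (integrable_natCast_poissonMeasure r).comp_fst _

lemma integrable_snd_poissonMeasure_prod (r : ℝ≥0) :
    Integrable (fun p : ℕ × ℕ => (p.2 : ℝ)) ((poissonMeasure r).prod (poissonMeasure r)) :=
  (integrable_natCast_poissonMeasure r).comp_snd _

/-- Stein's identity with the other coordinate frozen; boundedness of `G` justifies Fubini. -/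
lemma integral_fst_mul_poissonMeasure_prod {G : ℕ × ℕ → ℝ} {C : ℝ} (hG : ∀ p, |G p| ≤ C) :
    ∫ p : ℕ × ℕ, (p.1 : ℝ) * G p ∂((poissonMeasure r).prod (poissonMeasure r))
      = r * ∫ p : ℕ × ℕ, G (p.1 + 1, p.2) ∂((poissonMeasure r).prod (poissonMeasure r)) := by
  have h1 : Integrable (fun p : ℕ × ℕ => (p.1 : ℝ) * G p)
      ((poissonMeasure r).prod (poissonMeasure r)) :=
    (integrable_fst_poissonMeasure_prod r).mul_bdd
      Measurable.of_discrete.aestronglyMeasurable (ae_of_all _ hG)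
  rw [integral_prod_symm _ h1,
    integral_prod_symm _ (integrable_of_forall_abs_le fun p => hG (p.1 + 1, p.2)),
    ← integral_const_mul]
  refine integral_congr_ae (ae_of_all _ fun l => ?_)
  exact integral_natCast_mul_poissonMeasure (g := fun k => G (k, l))
    (integrable_of_forall_abs_le fun k => hG (k + 1, l))

lemma integral_snd_mul_poissonMeasure_prod {G : ℕ × ℕ → ℝ} {C : ℝ} (hG : ∀ p, |G p| ≤ C) :
    ∫ p : ℕ × ℕ, (p.2 : ℝ) * G p ∂((poissonMeasure r).prod (poissonMeasure r))
      = r * ∫ p : ℕ × ℕ, G (p.1, p.2 + 1) ∂((poissonMeasure r).prod (poissonMeasure r)) := by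
  have h := integral_fst_mul_poissonMeasure_prod (r := r) (G := fun p => G p.swap)
    (fun p => hG p.swap)
  rw [← integral_prod_swap, ← integral_prod_swap (f := fun p : ℕ × ℕ => G (p.1, p.2 + 1))]
  exact h

lemma abs_intCast_sign_le_one (d : ℤ) : |((d.sign : ℤ) : ℝ)| ≤ 1 := by
  obtain h | h | h := lt_trichotomy d 0
  · simp [Int.sign_eq_neg_one_of_neg h]
  · simp [h]
  · simp [Int.sign_eq_one_of_pos h]

lemma abs_intCast_eq_mul_sign (d : ℤ) : |(d : ℝ)| = d * ((d.sign : ℤ) : ℝ) := by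
  rw [← Int.cast_mul, Int.mul_sign_self, Int.natCast_natAbs, Int.cast_abs]

lemma integral_sub_mul_poissonMeasure_prod {G : ℕ × ℕ → ℝ} {C : ℝ} (hG : ∀ p, |G p| ≤ C) :
    ∫ p : ℕ × ℕ, ((p.1 : ℝ) - p.2) * G p ∂((poissonMeasure r).prod (poissonMeasure r))
      = r * ∫ p : ℕ × ℕ, (G (p.1 + 1, p.2) - G (p.1, p.2 + 1))
          ∂((poissonMeasure r).prod (poissonMeasure r)) := by
  have i1 : Integrable (fun p : ℕ × ℕ => (p.1 : ℝ) * G p)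
      ((poissonMeasure r).prod (poissonMeasure r)) :=
    (integrable_fst_poissonMeasure_prod r).mul_bdd
      Measurable.of_discrete.aestronglyMeasurable (ae_of_all _ hG)
  have i2 : Integrable (fun p : ℕ × ℕ => (p.2 : ℝ) * G p)
      ((poissonMeasure r).prod (poissonMeasure r)) :=
    (integrable_snd_poissonMeasure_prod r).mul_bdd
      Measurable.of_discrete.aestronglyMeasurable (ae_of_all _ hG)
  have j1 : Integrable (fun p : ℕ × ℕ => G (p.1 + 1, p.2))
      ((poissonMeasure r).prod (poissonMeasure r)) := integrable_of_forall_abs_le fun p => hG _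
  have j2 : Integrable (fun p : ℕ × ℕ => G (p.1, p.2 + 1))
      ((poissonMeasure r).prod (poissonMeasure r)) := integrable_of_forall_abs_le fun p => hG _
  simp_rw [sub_mul]
  rw [integral_sub i1 i2, integral_fst_mul_poissonMeasure_prod hG,
    integral_snd_mul_poissonMeasure_prod hG, integral_sub j1 j2, mul_sub]

/-- Write `|d| = d sign d` with `d = K - L` and apply Stein's identity in each coordinate: raising
`K` moves `d` to `d + 1`, raising `L` moves it to `d - 1`. -/
lemma integral_abs_sub_eq_sign_poissonMeasure (r : ℝ≥0) :
    ∫ p : ℕ × ℕ, |(p.1 : ℝ) - p.2| ∂((poissonMeasure r).prod (poissonMeasure r))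
      = r * ∫ p : ℕ × ℕ, ((((p.1 : ℤ) - p.2 + 1).sign - ((p.1 : ℤ) - p.2 - 1).sign : ℤ) : ℝ)
          ∂((poissonMeasure r).prod (poissonMeasure r)) := by
  have h := integral_sub_mul_poissonMeasure_prod (r := r)
    (G := fun p : ℕ × ℕ => ((((p.1 : ℤ) - p.2).sign : ℤ) : ℝ)) (C := 1)
    (fun p => abs_intCast_sign_le_one _)
  have e : ∀ p : ℕ × ℕ, |(p.1 : ℝ) - p.2|
      = ((p.1 : ℝ) - p.2) * ((((p.1 : ℤ) - p.2).sign : ℤ) : ℝ) := by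
    intro p
    have := abs_intCast_eq_mul_sign ((p.1 : ℤ) - p.2)
    rwa [Int.cast_sub, Int.cast_natCast, Int.cast_natCast] at this
  have e' : ∀ p : ℕ × ℕ, ((((p.1 : ℤ) - p.2 + 1).sign - ((p.1 : ℤ) - p.2 - 1).sign : ℤ) : ℝ)
      = (((((p.1 + 1 : ℕ) : ℤ) - p.2).sign : ℤ) : ℝ)
        - ((((p.1 : ℤ) - ((p.2 + 1 : ℕ) : ℤ)).sign : ℤ) : ℝ) := by
    intro p
    rw [Int.cast_sub]
    rw [show ((p.1 + 1 : ℕ) : ℤ) - p.2 = p.1 - p.2 + 1 by push_cast; ring,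
      show (p.1 : ℤ) - ((p.2 + 1 : ℕ) : ℤ) = p.1 - p.2 - 1 by push_cast; ring]
  simp_rw [e, e']
  exact h

/-- By independence this is `|φ(t)|²` for the characteristic function `φ(t) = exp(r(e^{it} - 1))`;
its real and imaginary parts are the means of `cos` and `sin`. -/
lemma integral_cos_mul_sub_poissonMeasure (r : ℝ≥0) (t : ℝ) :
    ∫ p : ℕ × ℕ, Real.cos (((p.1 : ℝ) - p.2) * t) ∂((poissonMeasure r).prod (poissonMeasure r))
      = Real.exp (2 * r * (Real.cos t - 1)) := by
  have hφ := charFun_map_cast_poissonMeasure r t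
  have hint : Integrable (fun k : ℕ => Complex.exp ((k * t : ℝ) * Complex.I))
      (poissonMeasure r) :=
    Integrable.of_bound Measurable.of_discrete.aestronglyMeasurable 1
      (ae_of_all _ fun k => by rw [Complex.norm_exp_ofReal_mul_I])
  rw [charFun_apply_real, integral_map .of_discrete (by fun_prop)] at hφ
  have hφ' : ∫ k : ℕ, Complex.exp ((k * t : ℝ) * Complex.I) ∂(poissonMeasure r)
      = Complex.exp (r * (Complex.exp (t * Complex.I) - 1)) := by
    rw [← hφ]
    congr 1 with k
    push_cast
    ring_nf
  have hre : ∫ k : ℕ, Real.cos (k * t) ∂(poissonMeasure r)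
      = (Complex.exp (r * (Complex.exp (t * Complex.I) - 1))).re := by
    rw [← hφ', ← RCLike.re_eq_complex_re, ← integral_re hint]
    congr 1 with k
    rw [RCLike.re_eq_complex_re, Complex.exp_ofReal_mul_I_re]
  have him : ∫ k : ℕ, Real.sin (k * t) ∂(poissonMeasure r)
      = (Complex.exp (r * (Complex.exp (t * Complex.I) - 1))).im := by
    rw [← hφ', ← RCLike.im_eq_complex_im, ← integral_im hint]
    congr 1 with k
    rw [RCLike.im_eq_complex_im, Complex.exp_ofReal_mul_I_im]
  have e : ∀ p : ℕ × ℕ, Real.cos (((p.1 : ℝ) - p.2) * t)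
      = Real.cos (p.1 * t) * Real.cos (p.2 * t) + Real.sin (p.1 * t) * Real.sin (p.2 * t) := by
    intro p
    rw [sub_mul, Real.cos_sub]
  have ic : Integrable (fun k : ℕ => Real.cos (k * t)) (poissonMeasure r) :=
    integrable_of_forall_abs_le (C := 1) fun k => Real.abs_cos_le_one _
  have is : Integrable (fun k : ℕ => Real.sin (k * t)) (poissonMeasure r) :=
    integrable_of_forall_abs_le (C := 1) fun k => Real.abs_sin_le_one _
  simp_rw [e]
  rw [integral_add (ic.mul_prod ic) (is.mul_prod is),
    integral_prod_mul (fun k : ℕ => Real.cos (k * t)) (fun k : ℕ => Real.cos (k * t)),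
    integral_prod_mul (fun k : ℕ => Real.sin (k * t)) (fun k : ℕ => Real.sin (k * t)), hre, him,
    ← Complex.normSq_apply, Complex.normSq_eq_norm_sq, Complex.norm_exp, ← Real.exp_nat_mul]
  congr 1
  simp [Complex.exp_ofReal_mul_I_re]
  ring

/-- Replace the sign kernel by its Fourier integral and exchange the integrals, the integrand being
bounded by 2. -/
lemma integral_abs_sub_poissonMeasure (r : ℝ≥0) :
    ∫ p : ℕ × ℕ, |(p.1 : ℝ) - p.2| ∂((poissonMeasure r).prod (poissonMeasure r))
      = r / π * ∫ t in (-π)..π, (1 + Real.cos t) * Real.exp (2 * r * (Real.cos t - 1)) := by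
  rw [integral_abs_sub_eq_sign_poissonMeasure]
  have e : ∀ p : ℕ × ℕ, ((((p.1 : ℤ) - p.2 + 1).sign - ((p.1 : ℤ) - p.2 - 1).sign : ℤ) : ℝ)
      = π⁻¹ * ∫ t in (-π)..π, (1 + Real.cos t) * Real.cos (((p.1 : ℝ) - p.2) * t) := by
    intro p
    have := integral_one_add_cos_mul_cos ((p.1 : ℤ) - p.2)
    push_cast at this ⊢
    rw [this, inv_mul_cancel_left₀ Real.pi_ne_zero]
  simp_rw [e]
  rw [integral_const_mul, ← intervalIntegral_integral_swap, div_eq_mul_inv, mul_assoc]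
  · congr 3 with t
    rw [integral_const_mul, integral_cos_mul_sub_poissonMeasure]
  · have : IsFiniteMeasure (volume.restrict (Set.uIoc (-π) π)) :=
      ⟨by rw [Measure.restrict_apply_univ]; exact measure_Ioc_lt_top⟩
    refine Integrable.of_bound (Measurable.aestronglyMeasurable ?_) 2 (ae_of_all _ fun q => ?_)
    · have : Measurable fun p : ℕ × ℕ => (p.1 : ℝ) - p.2 := .of_discrete
      unfold Function.uncurry
      fun_prop
    · rw [Function.uncurry, norm_mul]
      have h1 : ‖1 + Real.cos q.1‖ ≤ 2 := by
        rw [Real.norm_eq_abs, abs_le]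
        constructor <;> linarith [Real.neg_one_le_cos q.1, Real.cos_le_one q.1]
      have h2 : ‖Real.cos (((q.2.1 : ℝ) - q.2.2) * q.1)‖ ≤ 1 := Real.abs_cos_le_one _
      nlinarith [norm_nonneg (1 + Real.cos q.1)]

/-- The Gini mean difference of the Poisson distribution is asymptotic to `2 √(r / π)`. -/
lemma tendsto_integral_abs_sub_poissonMeasure_div_sqrt {r : ℕ → ℝ≥0}
    (hr : Tendsto (fun m => (r m : ℝ)) atTop atTop) :
    Tendsto (fun m => (∫ p : ℕ × ℕ, |(p.1 : ℝ) - p.2|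
      ∂((poissonMeasure (r m)).prod (poissonMeasure (r m)))) / √(r m : ℝ))
      atTop (𝓝 (2 / √π)) := by
  have h := (tendsto_sqrt_mul_integral_one_add_cos_mul_exp.comp hr).const_mul π⁻¹
  have hval : π⁻¹ * (2 * √π) = 2 / √π := by
    have : π = √π ^ 2 := (Real.sq_sqrt Real.pi_pos.le).symm
    have h0 : √π ≠ 0 := (Real.sqrt_pos.2 Real.pi_pos).ne'
    nth_rewrite 1 [this]
    field_simp
  rw [hval] at h
  refine h.congr fun m => ?_
  rw [integral_abs_sub_poissonMeasure, Function.comp_apply, mul_div_right_comm, div_right_comm,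
    Real.div_sqrt]
  ring

end PoissonAbsDiffMean

/-! ### Asymptotics of `E F(K/m)` and `E F(min(K,L)/m)` -/

section SzaszOperator

open scoped NNReal Real

variable {F f df : ℝ → ℝ} {x : ℝ}

/-- A Taylor bound valid for all `t`, ready to be integrated. Near `x` the mean value inequality
gives the `ε` term; away from `x` boundedness of `F` lets the quartic term absorb everything. -/
lemma SmoothHalfLineCDF.exists_abs_sub_taylor_le (hF : SmoothHalfLineCDF F f df)
    (hF1 : ∀ t, |F t| ≤ 1) (hx : 0 < x) {ε : ℝ} (hε : 0 < ε) :
    ∃ C, 0 ≤ C ∧ ∀ t, |F t - F x - f x * (t - x) - df x / 2 * (t - x) ^ 2|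
      ≤ ε * (t - x) ^ 2 + C * (t - x) ^ 4 := by
  have hf : HasDerivAt f (df x) x :=
    (hF.hasSecondDeriv x hx.le).hasDerivAt (Ici_mem_nhds hx)
  obtain ⟨δ₀, hδ₀, hδ⟩ := Metric.eventually_nhds_iff.1
    ((hasDerivAt_iff_isLittleO.1 hf).def hε)
  -- `δ ≤ x` keeps the neighbourhood inside `s > 0`, where the one-sided derivatives are two-sided.
  obtain ⟨δ, hδpos, hδle, hδx⟩ : ∃ δ, 0 < δ ∧ δ ≤ δ₀ ∧ δ ≤ x :=
    ⟨min δ₀ x, lt_min hδ₀ hx, min_le_left _ _, min_le_right _ _⟩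
  -- With `v = |t - x|/δ ≥ 1` the far error is at most `2 + |f x| δ v + |df x / 2| δ² v²`, and `1`,
  -- `v`, `v²` are all at most `v⁴`.
  refine ⟨(2 + |f x| * δ + |df x / 2| * δ ^ 2) / δ ^ 4, by positivity, fun t => ?_⟩
  rcases lt_or_ge |t - x| δ with h | h
  · have hd : ∀ s ∈ Metric.closedBall x |t - x|,
        HasDerivWithinAt (fun s => F s - F x - f x * (s - x) - df x / 2 * (s - x) ^ 2)
          (f s - f x - (s - x) * df x) (Metric.closedBall x |t - x|) s := by
      intro s hs
      have hs' : |s - x| < δ := (Real.dist_eq s x ▸ Metric.mem_closedBall.1 hs).trans_lt h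
      have hs0 : 0 < s := by linarith [(abs_lt.1 hs').1]
      have h1 : HasDerivAt F (f s) s :=
        (hF.hasDeriv s hs0.le).hasDerivAt (Ici_mem_nhds hs0)
      have h2 : HasDerivAt (fun s => s - x) 1 s := (hasDerivAt_id s).sub_const x
      have h3 := ((h1.sub_const (F x)).sub (h2.const_mul (f x))).sub
        ((h2.pow 2).const_mul (df x / 2))
      refine (h3.congr_deriv ?_).hasDerivWithinAt
      simp
      ring
    have hb : ∀ s ∈ Metric.closedBall x |t - x|, ‖f s - f x - (s - x) * df x‖ ≤ ε * |t - x| := by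
      intro s hs
      have hs1 : |s - x| ≤ |t - x| := Real.dist_eq s x ▸ Metric.mem_closedBall.1 hs
      have := hδ (y := s) (by rw [Real.dist_eq]; linarith)
      simp only [smul_eq_mul, Real.norm_eq_abs] at this
      rw [Real.norm_eq_abs]
      exact this.trans (by gcongr)
    have h4 := Convex.norm_image_sub_le_of_norm_hasDerivWithin_le hd hb
      (convex_closedBall x |t - x|) (Metric.mem_closedBall_self (abs_nonneg _))
      (Metric.mem_closedBall.2 (Real.dist_eq t x).le)
    simp only [sub_self, mul_zero, ne_eq, OfNat.ofNat_ne_zero, not_false_eq_true, zero_pow,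
      sub_zero, Real.norm_eq_abs] at h4
    rw [mul_assoc, abs_mul_abs_self, ← sq] at h4
    have : 0 ≤ (2 + |f x| * δ + |df x / 2| * δ ^ 2) / δ ^ 4 * (t - x) ^ 4 := by positivity
    linarith
  · obtain ⟨v, hv⟩ : ∃ v, v = |t - x| / δ := ⟨_, rfl⟩
    have hv1 : 1 ≤ v := by rw [hv, le_div_iff₀ hδpos]; linarith
    have hu : |t - x| = δ * v := by rw [hv]; field_simp
    have hu2 : (t - x) ^ 2 = δ ^ 2 * v ^ 2 := by rw [← sq_abs, hu]; ring
    have hu4 : (t - x) ^ 4 = δ ^ 4 * v ^ 4 := by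
      rw [show (t - x) ^ 4 = ((t - x) ^ 2) ^ 2 by ring, hu2]; ring
    have habs : |F t - F x - f x * (t - x) - df x / 2 * (t - x) ^ 2|
        ≤ 2 + |f x| * |t - x| + |df x / 2| * (t - x) ^ 2 := by
      have a1 := abs_sub (F t - F x - f x * (t - x)) (df x / 2 * (t - x) ^ 2)
      have a2 := abs_sub (F t - F x) (f x * (t - x))
      have a3 := abs_sub (F t) (F x)
      rw [abs_mul] at a2
      rw [abs_mul, abs_of_nonneg (sq_nonneg (t - x))] at a1
      linarith [hF1 t, hF1 x]
    have p1 : 1 ≤ v ^ 4 := one_le_pow₀ hv1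
    have p2 : v ≤ v ^ 4 := le_self_pow₀ hv1 (by norm_num)
    have p3 : v ^ 2 ≤ v ^ 4 := pow_le_pow_right₀ hv1 (by norm_num)
    have e : (2 + |f x| * δ + |df x / 2| * δ ^ 2) / δ ^ 4 * (t - x) ^ 4
        = 2 * v ^ 4 + |f x| * δ * v ^ 4 + |df x / 2| * δ ^ 2 * v ^ 4 := by
      rw [hu4]; field_simp
    rw [e]
    refine habs.trans ?_
    have q2 : |f x| * |t - x| ≤ |f x| * δ * v ^ 4 := by
      rw [hu, ← mul_assoc]; gcongr
    have q3 : |df x / 2| * (t - x) ^ 2 ≤ |df x / 2| * δ ^ 2 * v ^ 4 := by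
      rw [hu2, ← mul_assoc]; gcongr
    have q4 : 0 ≤ ε * (t - x) ^ 2 := by positivity
    linarith

/-- The mean `m x` of the Poisson distribution given by the weights `szaszWeight · m x`. -/
noncomputable def szaszRate (m : ℕ) (x : ℝ) : ℝ≥0 := ((m : ℝ) * x).toNNReal

lemma coe_szaszRate (m : ℕ) (hx : 0 ≤ x) : (szaszRate m x : ℝ) = m * x :=
  Real.coe_toNNReal _ (by positivity)

lemma integrable_div_sub_pow_szaszRate (m : ℕ) (x : ℝ) (p : ℕ) :
    Integrable (fun k : ℕ => ((k : ℝ) / m - x) ^ p) (poissonMeasure (szaszRate m x)) := by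
  by_cases hm : m = 0
  · simp [hm]
  · have hm' : (m : ℝ) ≠ 0 := by exact_mod_cast hm
    refine ((integrable_add_pow_poissonMeasure _ p (-(m * x))).const_mul
      (((m : ℝ) ^ p)⁻¹)).congr (ae_of_all _ fun k => ?_)
    simp only
    rw [← inv_pow, ← mul_pow]
    congr 1
    field_simp
    ring

lemma integral_div_sub_szaszRate {m : ℕ} (hm : 1 ≤ m) (hx : 0 ≤ x) :
    ∫ k : ℕ, ((k : ℝ) / m - x) ∂(poissonMeasure (szaszRate m x)) = 0 := by
  have hm' : (m : ℝ) ≠ 0 := by positivity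
  rw [integral_sub ((integrable_natCast_poissonMeasure _).div_const _) (integrable_const _),
    integral_div, integral_natCast_poissonMeasure, coe_szaszRate m hx]
  simp
  field_simp
  ring

lemma integral_div_sub_sq_szaszRate {m : ℕ} (hm : 1 ≤ m) (hx : 0 ≤ x) :
    ∫ k : ℕ, ((k : ℝ) / m - x) ^ 2 ∂(poissonMeasure (szaszRate m x)) = x / m := by
  have hm' : (m : ℝ) ≠ 0 := by positivity
  have h := integral_sub_sq_poissonMeasure (szaszRate m x)
  rw [coe_szaszRate m hx] at h
  have e : ∀ k : ℕ, ((k : ℝ) / m - x) ^ 2 = ((m : ℝ) ^ 2)⁻¹ * ((k : ℝ) - m * x) ^ 2 := by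
    intro k
    field_simp
  simp_rw [e]
  rw [integral_const_mul, h]
  field_simp

/-- The exact value is `3x²/m² + x/m³`; the order `m⁻²` is all that is needed. -/
lemma integral_div_sub_pow_four_szaszRate_le {m : ℕ} (hm : 1 ≤ m) (hx : 0 ≤ x) :
    ∫ k : ℕ, ((k : ℝ) / m - x) ^ 4 ∂(poissonMeasure (szaszRate m x))
      ≤ (3 * x ^ 2 + x) / (m : ℝ) ^ 2 := by
  have hm' : (m : ℝ) ≠ 0 := by positivity
  have hm1 : (1 : ℝ) ≤ m := by exact_mod_cast hm
  have h := integral_sub_pow_four_poissonMeasure (szaszRate m x)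
  rw [coe_szaszRate m hx] at h
  have e : ∀ k : ℕ, ((k : ℝ) / m - x) ^ 4 = ((m : ℝ) ^ 4)⁻¹ * ((k : ℝ) - m * x) ^ 4 := by
    intro k
    field_simp
  simp_rw [e]
  rw [integral_const_mul, h, inv_mul_eq_div, div_le_div_iff₀ (by positivity) (by positivity)]
  have : (m : ℝ) * x ≤ m ^ 2 * x := by
    have : (m : ℝ) ≤ m ^ 2 := le_self_pow₀ hm1 (by norm_num)
    gcongr
  calc (3 * ((m : ℝ) * x) ^ 2 + m * x) * m ^ 2 ≤ (3 * ((m : ℝ) * x) ^ 2 + m ^ 2 * x) * m ^ 2 := by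
        gcongr
    _ = _ := by ring

/-- `C` may depend on `ε`, as the quartic Taylor constant does. -/
lemma tendsto_of_forall_abs_sub_le {u : ℕ → ℝ} {a : ℝ}
    (h : ∀ ε > 0, ∃ C, ∀ m : ℕ, 1 ≤ m → |u m - a| ≤ ε + C / m) : Tendsto u atTop (𝓝 a) := by
  rw [Metric.tendsto_nhds]
  intro ε hε
  obtain ⟨C, hC⟩ := h (ε / 2) (by positivity)
  have h2 : Tendsto (fun m : ℕ => C / (m : ℝ)) atTop (𝓝 0) :=
    tendsto_natCast_atTop_atTop.const_div_atTop C
  filter_upwards [eventually_ge_atTop 1, h2.eventually_lt_const (half_pos hε)] with m hm h3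
  rw [Real.dist_eq]
  linarith [hC m hm]

lemma tendsto_mul_integral_szaszRate_sub (hF : SmoothHalfLineCDF F f df)
    (hF1 : ∀ t, |F t| ≤ 1) (hx : 0 < x) :
    Tendsto (fun m : ℕ => (m : ℝ) *
      (∫ k : ℕ, F ((k : ℝ) / m) ∂(poissonMeasure (szaszRate m x)) - F x))
      atTop (𝓝 (szaszB df x)) := by
  refine tendsto_of_forall_abs_sub_le fun ε hε => ?_
  -- The variance of `K/m` is `x/m`, so tolerance `ε / x` contributes exactly `ε` after
  -- multiplication by `m`.
  obtain ⟨C, hC, hb⟩ := hF.exists_abs_sub_taylor_le hF1 hx (div_pos hε hx)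
  refine ⟨C * (3 * x ^ 2 + x), fun m hm => ?_⟩
  have hm' : (0 : ℝ) < m := by exact_mod_cast hm
  have hi := integrable_div_sub_pow_szaszRate m x
  have h1 : Integrable (fun k : ℕ => (k : ℝ) / m - x) (poissonMeasure (szaszRate m x)) := by
    simpa using hi 1
  have h2 := hi 2
  have h4 := hi 4
  have hFi : Integrable (fun k : ℕ => F ((k : ℝ) / m)) (poissonMeasure (szaszRate m x)) :=
    integrable_of_forall_abs_le fun k => hF1 _
  have hR : ∫ k : ℕ, (F ((k : ℝ) / m) - F x - f x * ((k : ℝ) / m - x)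
      - df x / 2 * ((k : ℝ) / m - x) ^ 2) ∂(poissonMeasure (szaszRate m x))
      = ∫ k : ℕ, F ((k : ℝ) / m) ∂(poissonMeasure (szaszRate m x)) - F x
        - df x / 2 * (x / m) := by
    have hFx : Integrable (fun k : ℕ => F ((k : ℝ) / m) - F x) (poissonMeasure (szaszRate m x)) :=
      hFi.sub (integrable_const _)
    have hFf : Integrable (fun k : ℕ => F ((k : ℝ) / m) - F x - f x * ((k : ℝ) / m - x))
        (poissonMeasure (szaszRate m x)) := hFx.sub (h1.const_mul _)
    rw [integral_sub hFf (h2.const_mul _), integral_sub hFx (h1.const_mul _),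
      integral_sub hFi (integrable_const _), integral_const_mul, integral_const_mul,
      integral_div_sub_szaszRate hm hx.le, integral_div_sub_sq_szaszRate hm hx.le]
    simp
  have hle : |∫ k : ℕ, F ((k : ℝ) / m) ∂(poissonMeasure (szaszRate m x)) - F x
        - df x / 2 * (x / m)| ≤ ε / x * (x / m) + C * ((3 * x ^ 2 + x) / (m : ℝ) ^ 2) := by
    rw [← hR, ← Real.norm_eq_abs]
    refine (norm_integral_le_of_norm_le ((h2.const_mul (ε / x)).add (h4.const_mul C))
      (ae_of_all _ fun k => hb _)).trans ?_
    rw [integral_add' (h2.const_mul (ε / x)) (h4.const_mul C), integral_const_mul,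
      integral_const_mul, integral_div_sub_sq_szaszRate hm hx.le]
    gcongr
    exact integral_div_sub_pow_four_szaszRate_le hm hx.le
  calc _ = m * |∫ k : ℕ, F ((k : ℝ) / m) ∂(poissonMeasure (szaszRate m x)) - F x
        - df x / 2 * (x / m)| := by
        rw [← abs_of_pos hm', ← abs_mul, abs_of_pos hm', szaszB]
        congr 1
        field_simp
    _ ≤ m * (ε / x * (x / m) + C * ((3 * x ^ 2 + x) / (m : ℝ) ^ 2)) := by gcongr
    _ = _ := by field_simp

/-- From `min(a,b) = (a + b - |a - b|)/2`, where `K/m` and `L/m` both have mean `x`. -/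
lemma integral_min_div_sub_szaszRate {m : ℕ} (hm : 1 ≤ m) (hx : 0 ≤ x) :
    ∫ p : ℕ × ℕ, (min (p.1 : ℝ) p.2 / m - x)
        ∂((poissonMeasure (szaszRate m x)).prod (poissonMeasure (szaszRate m x)))
      = -(∫ p : ℕ × ℕ, |(p.1 : ℝ) - p.2|
        ∂((poissonMeasure (szaszRate m x)).prod (poissonMeasure (szaszRate m x)))) / (2 * m) := by
  have hm' : (m : ℝ) ≠ 0 := by positivity
  have hi : Integrable (fun k : ℕ => (k : ℝ) / m - x) (poissonMeasure (szaszRate m x)) := by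
    simpa using integrable_div_sub_pow_szaszRate m x 1
  have i1 := hi.comp_fst (poissonMeasure (szaszRate m x))
  have i2 := hi.comp_snd (poissonMeasure (szaszRate m x))
  have i3 : Integrable (fun p : ℕ × ℕ => |(p.1 : ℝ) - p.2|)
      ((poissonMeasure (szaszRate m x)).prod (poissonMeasure (szaszRate m x))) :=
    ((integrable_fst_poissonMeasure_prod _).sub (integrable_snd_poissonMeasure_prod _)).abs
  have e : ∀ p : ℕ × ℕ, min (p.1 : ℝ) p.2 / m - x
      = (1 / 2) * ((p.1 : ℝ) / m - x) + (1 / 2) * ((p.2 : ℝ) / m - x)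
        - (1 / (2 * m)) * |(p.1 : ℝ) - p.2| := by
    intro p
    rcases le_total (p.1 : ℝ) p.2 with h | h
    · rw [min_eq_left h, abs_of_nonpos (by linarith)]
      field_simp
      ring
    · rw [min_eq_right h, abs_of_nonneg (by linarith)]
      field_simp
      ring
  have i12 : Integrable (fun p : ℕ × ℕ => (1 / 2 : ℝ) * ((p.1 : ℝ) / m - x)
      + (1 / 2) * ((p.2 : ℝ) / m - x))
      ((poissonMeasure (szaszRate m x)).prod (poissonMeasure (szaszRate m x))) :=
    (i1.const_mul _).add (i2.const_mul _)
  simp_rw [e]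
  rw [integral_sub i12 (i3.const_mul _),
    integral_add (i1.const_mul _) (i2.const_mul _), integral_const_mul, integral_const_mul,
    integral_const_mul,
    integral_fun_fst (μ := poissonMeasure (szaszRate m x)) (fun k : ℕ => (k : ℝ) / m - x),
    integral_fun_snd (ν := poissonMeasure (szaszRate m x)) (fun k : ℕ => (k : ℝ) / m - x),
    integral_div_sub_szaszRate hm hx]
  simp
  ring

lemma min_div_sub_pow_le (a b m x : ℝ) {p : ℕ} (hp : Even p) :
    (min a b / m - x) ^ p ≤ (a / m - x) ^ p + (b / m - x) ^ p := by
  have h1 := hp.pow_nonneg (a / m - x)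
  have h2 := hp.pow_nonneg (b / m - x)
  rcases min_choice a b with h | h <;> rw [h] <;> linarith

lemma tendsto_sqrt_mul_integral_min_szaszRate_sub (hF : SmoothHalfLineCDF F f df)
    (hF1 : ∀ t, |F t| ≤ 1) (hx : 0 < x) :
    Tendsto (fun m : ℕ => √(m : ℝ) *
      (∫ p : ℕ × ℕ, F (min (p.1 : ℝ) p.2 / m)
        ∂((poissonMeasure (szaszRate m x)).prod (poissonMeasure (szaszRate m x))) - F x))
      atTop (𝓝 (-szaszV f x)) := by
  -- Tolerance `1` suffices: all terms beyond the linear one are `O(1/m)`, negligible at scale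
  -- `m^(-1/2)`.
  obtain ⟨C, hC, hb⟩ := hF.exists_abs_sub_taylor_le hF1 hx one_pos
  obtain ⟨A, hA⟩ : ∃ A, A = 1 + |df x / 2| := ⟨_, rfl⟩
  have hA0 : 0 ≤ A := by rw [hA]; positivity
  have hb' : ∀ t, |F t - F x - f x * (t - x)| ≤ A * (t - x) ^ 2 + C * (t - x) ^ 4 := by
    intro t
    have h := abs_sub_le (F t - F x - f x * (t - x)) (df x / 2 * (t - x) ^ 2) 0
    rw [sub_zero, sub_zero, abs_mul, abs_of_nonneg (sq_nonneg (t - x))] at h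
    rw [hA]
    linarith [hb t]
  let μ : ℕ → Measure (ℕ × ℕ) := fun m =>
    (poissonMeasure (szaszRate m x)).prod (poissonMeasure (szaszRate m x))
  obtain ⟨B, hB⟩ : ∃ B, B = A * (2 * x) + C * (2 * (3 * x ^ 2 + x)) := ⟨_, rfl⟩
  have hB0 : 0 ≤ B := by rw [hB]; positivity
  have hle : ∀ m : ℕ, 1 ≤ m → |∫ p : ℕ × ℕ, F (min (p.1 : ℝ) p.2 / m) ∂(μ m) - F x
      - f x * ∫ p : ℕ × ℕ, (min (p.1 : ℝ) p.2 / m - x) ∂(μ m)| ≤ B / m := by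
    intro m hm
    have hm' : (0 : ℝ) < m := by exact_mod_cast hm
    have hm1 : (1 : ℝ) ≤ m := by exact_mod_cast hm
    have hi := integrable_div_sub_pow_szaszRate m x
    have i1 := fun p => (hi p).comp_fst (poissonMeasure (szaszRate m x))
    have i2 := fun p => (hi p).comp_snd (poissonMeasure (szaszRate m x))
    have hmin : Integrable (fun p : ℕ × ℕ => min (p.1 : ℝ) p.2 / m - x) (μ m) :=
      (((integrable_fst_poissonMeasure_prod _).inf
        (integrable_snd_poissonMeasure_prod _)).div_const _).sub (integrable_const _)
    have hFi : Integrable (fun p : ℕ × ℕ => F (min (p.1 : ℝ) p.2 / m)) (μ m) :=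
      integrable_of_forall_abs_le fun p => hF1 _
    have hR : ∫ p : ℕ × ℕ, (F (min (p.1 : ℝ) p.2 / m) - F x
        - f x * (min (p.1 : ℝ) p.2 / m - x)) ∂(μ m)
        = ∫ p : ℕ × ℕ, F (min (p.1 : ℝ) p.2 / m) ∂(μ m) - F x
          - f x * ∫ p : ℕ × ℕ, (min (p.1 : ℝ) p.2 / m - x) ∂(μ m) := by
      have hFx : Integrable (fun p : ℕ × ℕ => F (min (p.1 : ℝ) p.2 / m) - F x) (μ m) :=
        hFi.sub (integrable_const _)
      rw [integral_sub hFx (hmin.const_mul _),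
        integral_sub hFi (integrable_const _), integral_const_mul]
      simp
    rw [← hR, ← Real.norm_eq_abs]
    have j2 := ((i1 2).add (i2 2)).const_mul A
    have j4 := ((i1 4).add (i2 4)).const_mul C
    refine (norm_integral_le_of_norm_le (j2.add j4) (ae_of_all _ fun p => ?_)).trans ?_
    · refine (hb' _).trans ?_
      simp only [Pi.add_apply]
      have m2 := min_div_sub_pow_le p.1 p.2 m x (p := 2) (by decide)
      have m4 := min_div_sub_pow_le p.1 p.2 m x (p := 4) (by decide)
      gcongr
    · rw [integral_add' j2 j4, integral_const_mul, integral_const_mul,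
        integral_add' (i1 2) (i2 2), integral_add' (i1 4) (i2 4),
        integral_fun_fst (μ := poissonMeasure (szaszRate m x))
          (fun k : ℕ => ((k : ℝ) / m - x) ^ 2),
        integral_fun_snd (ν := poissonMeasure (szaszRate m x))
          (fun k : ℕ => ((k : ℝ) / m - x) ^ 2),
        integral_fun_fst (μ := poissonMeasure (szaszRate m x))
          (fun k : ℕ => ((k : ℝ) / m - x) ^ 4),
        integral_fun_snd (ν := poissonMeasure (szaszRate m x))
          (fun k : ℕ => ((k : ℝ) / m - x) ^ 4),
        integral_div_sub_sq_szaszRate hm hx.le]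
      simp only [probReal_univ, one_smul]
      have h4 := integral_div_sub_pow_four_szaszRate_le hm hx.le
      have h5 : (3 * x ^ 2 + x) / (m : ℝ) ^ 2 ≤ (3 * x ^ 2 + x) / m := by
        gcongr
        exact le_self_pow₀ hm1 (by norm_num)
      calc _ ≤ A * (x / m + x / m)
            + C * ((3 * x ^ 2 + x) / m + (3 * x ^ 2 + x) / m) := by gcongr <;> linarith
        _ = B / m := by rw [hB]; field_simp; ring
  have hrate : Tendsto (fun m : ℕ => (szaszRate m x : ℝ)) atTop atTop := by
    simp_rw [coe_szaszRate _ hx.le]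
    exact tendsto_natCast_atTop_atTop.atTop_mul_const hx
  have hmain : Tendsto (fun m : ℕ => f x * (√(m : ℝ) *
      ∫ p : ℕ × ℕ, (min (p.1 : ℝ) p.2 / m - x) ∂(μ m))) atTop (𝓝 (-szaszV f x)) := by
    -- The factor combines the `1/2` of the `min` identity with `√(mx) = √m √x`.
    have h := (tendsto_integral_abs_sub_poissonMeasure_div_sqrt hrate).const_mul
      (-(f x * (√x / 2)))
    have hval : -(f x * (√x / 2)) * (2 / √π) = -szaszV f x := by
      rw [szaszV, Real.sqrt_div hx.le]; ring
    rw [hval] at h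
    refine h.congr' ?_
    filter_upwards [eventually_ge_atTop 1] with m hm
    have hm' : (0 : ℝ) < m := by exact_mod_cast hm
    have hs : 0 < √(m : ℝ) := Real.sqrt_pos.2 hm'
    have hsx : 0 < √x := Real.sqrt_pos.2 hx
    have hsq : (m : ℝ) = √(m : ℝ) ^ 2 := (Real.sq_sqrt hm'.le).symm
    rw [integral_min_div_sub_szaszRate hm hx.le, coe_szaszRate m hx.le, Real.sqrt_mul hm'.le]
    have key : ∀ I : ℝ, -(f x * (√x / 2)) * (I / (√(m : ℝ) * √x))
        = f x * (√(m : ℝ) * (-I / (2 * m))) := by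
      intro I
      have : √(m : ℝ) * (-I / (2 * m)) = -I / (2 * √(m : ℝ)) := by
        rw [mul_div_assoc', div_eq_div_iff (by positivity) (by positivity)]
        linear_combination 2 * I * hsq
      rw [this]
      field_simp
    exact key _
  have hrem : Tendsto (fun m : ℕ => √(m : ℝ) * (∫ p : ℕ × ℕ, F (min (p.1 : ℝ) p.2 / m) ∂(μ m)
      - F x - f x * ∫ p : ℕ × ℕ, (min (p.1 : ℝ) p.2 / m - x) ∂(μ m))) atTop (𝓝 0) := by
    have h0 : Tendsto (fun m : ℕ => B / √(m : ℝ)) atTop (𝓝 0) :=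
      (Real.tendsto_sqrt_atTop.comp tendsto_natCast_atTop_atTop).const_div_atTop B
    refine squeeze_zero_norm' ?_ h0
    filter_upwards [eventually_ge_atTop 1] with m hm
    have hm' : (0 : ℝ) < m := by exact_mod_cast hm
    have hs : 0 < √(m : ℝ) := Real.sqrt_pos.2 hm'
    rw [norm_mul, Real.norm_eq_abs, Real.norm_eq_abs, abs_of_pos hs]
    calc _ ≤ √(m : ℝ) * (B / m) := by gcongr; exact hle m hm
      _ = B / √(m : ℝ) := by
        rw [mul_div_assoc', div_eq_div_iff (by positivity) (by positivity)]
        linear_combination B * (Real.sq_sqrt hm'.le)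
  have h := hrem.add hmain
  rw [zero_add] at h
  refine h.congr fun m => ?_
  ring

end SzaszOperator

/-! ### Exact mean and variance of the estimator -/

section SzaszEstimator

open scoped NNReal Real

variable {Ω : Type*} [MeasurableSpace Ω] {P : Measure Ω} [IsProbabilityMeasure P] {x : ℝ}

/-- The Szasz smoothing `∑_k 𝟙(y ≤ k / m) V_{k,m}(x)` of the indicator of the observation `y`. -/
noncomputable def szaszSmoothing (m : ℕ) (x y : ℝ) : ℝ :=
  ∫ k : ℕ, (Set.Iic ((k : ℝ) / m)).indicator (fun _ => (1 : ℝ)) y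
    ∂(poissonMeasure (szaszRate m x))

lemma measurable_indicator_Iic_comp {S : Type*} [MeasurableSpace S] {T : S → ℝ}
    (hT : Measurable T) :
    Measurable fun q : ℝ × S => (Set.Iic (T q.2)).indicator (fun _ => (1 : ℝ)) q.1 :=
  measurable_const.indicator (measurableSet_le measurable_fst (hT.comp measurable_snd))

lemma abs_indicator_one_le (s : Set ℝ) (y : ℝ) :
    |s.indicator (fun _ => (1 : ℝ)) y| ≤ 1 := by
  by_cases h : y ∈ s <;> simp [h]

lemma measurable_szaszSmoothing (m : ℕ) (x : ℝ) : Measurable (szaszSmoothing m x) :=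
  ((measurable_indicator_Iic_comp (T := fun k : ℕ => (k : ℝ) / m)
    .of_discrete).stronglyMeasurable.integral_prod_right').measurable

lemma abs_szaszSmoothing_le (m : ℕ) (x y : ℝ) : |szaszSmoothing m x y| ≤ 1 := by
  have := norm_integral_le_of_norm_le_const (μ := poissonMeasure (szaszRate m x))
    (f := fun k : ℕ => (Set.Iic ((k : ℝ) / m)).indicator (fun _ => (1 : ℝ)) y) (C := 1)
    (ae_of_all _ fun k => abs_indicator_one_le _ y)
  simpa [szaszSmoothing] using this

/-- The series is a Poisson expectation, which commutes with the finite sum over the sample. -/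
lemma szaszEstimator_eq_sum {Ω : Type*} (X : ℕ → Ω → ℝ) (m n : ℕ) (hx : 0 ≤ x) (ω : Ω) :
    szaszEstimator X m n x ω
      = (n : ℝ)⁻¹ * ∑ i ∈ Finset.range n, szaszSmoothing m x (X i ω) := by
  have h : szaszEstimator X m n x ω = ∫ k : ℕ, empiricalCDF X n ((k : ℝ) / m) ω
      ∂(poissonMeasure (szaszRate m x)) := by
    rw [integral_poissonMeasure, szaszEstimator]
    refine tsum_congr fun k => ?_
    rw [szaszWeight, coe_szaszRate m hx, smul_eq_mul, mul_comm]
  rw [h]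
  simp only [empiricalCDF, szaszSmoothing]
  rw [integral_const_mul, integral_finsetSum]
  · rfl
  · intro i _
    exact integrable_of_forall_abs_le (C := 1) fun k =>
      abs_indicator_one_le (Set.Iic ((k : ℝ) / m)) (X i ω)

/-- Fubini for a general random threshold, serving both `K/m` and `min(K,L)/m`. -/
lemma integral_integral_indicator_Iic {S : Type*} [MeasurableSpace S] {ν : Measure S}
    [IsProbabilityMeasure ν] {T : S → ℝ} (hT : Measurable T) {Y : Ω → ℝ} (hY : Measurable Y) :
    ∫ ω, ∫ s, (Set.Iic (T s)).indicator (fun _ => (1 : ℝ)) (Y ω) ∂ν ∂P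
      = ∫ s, P.real {ω | Y ω ≤ T s} ∂ν := by
  rw [integral_integral_swap]
  · congr 1 with s
    exact integral_indicator_one (hY measurableSet_Iic)
  · refine Integrable.of_bound (Measurable.aestronglyMeasurable ?_) 1
      (ae_of_all _ fun q => abs_indicator_one_le _ _)
    exact (measurable_indicator_Iic_comp hT).comp
      ((hY.comp measurable_fst).prodMk measurable_snd)

lemma integral_szaszSmoothing {Y : Ω → ℝ} (hY : Measurable Y) {F : ℝ → ℝ}
    (hcdf : ∀ t, P.real {ω | Y ω ≤ t} = F t) (m : ℕ) (x : ℝ) :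
    ∫ ω, szaszSmoothing m x (Y ω) ∂P
      = ∫ k : ℕ, F ((k : ℝ) / m) ∂(poissonMeasure (szaszRate m x)) := by
  simp only [szaszSmoothing]
  rw [integral_integral_indicator_Iic (T := fun k : ℕ => (k : ℝ) / m) .of_discrete hY]
  simp_rw [hcdf]

/-- A squared expectation is one over two independent copies, and `y` lies below both thresholds
exactly when it lies below their minimum. -/
lemma szaszSmoothing_sq (m : ℕ) (x y : ℝ) :
    szaszSmoothing m x y ^ 2 = ∫ p : ℕ × ℕ,
      (Set.Iic (min (p.1 : ℝ) p.2 / m)).indicator (fun _ => (1 : ℝ)) y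
      ∂((poissonMeasure (szaszRate m x)).prod (poissonMeasure (szaszRate m x))) := by
  rw [sq, szaszSmoothing, ← integral_prod_mul]
  congr 1 with p
  have hmin : min (p.1 : ℝ) p.2 / m = min ((p.1 : ℝ) / m) ((p.2 : ℝ) / m) :=
    (min_div_div_right (by positivity) _ _).symm
  rw [hmin]
  simp only [Set.indicator_apply, Set.mem_Iic, le_min_iff, ite_and, mul_ite, mul_one, mul_zero]
  split_ifs <;> rfl

lemma integral_szaszSmoothing_sq {Y : Ω → ℝ} (hY : Measurable Y) {F : ℝ → ℝ}
    (hcdf : ∀ t, P.real {ω | Y ω ≤ t} = F t) (m : ℕ) (x : ℝ) :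
    ∫ ω, szaszSmoothing m x (Y ω) ^ 2 ∂P = ∫ p : ℕ × ℕ, F (min (p.1 : ℝ) p.2 / m)
      ∂((poissonMeasure (szaszRate m x)).prod (poissonMeasure (szaszRate m x))) := by
  simp_rw [szaszSmoothing_sq]
  rw [integral_integral_indicator_Iic (T := fun p : ℕ × ℕ => min (p.1 : ℝ) p.2 / m)
    .of_discrete hY]
  simp_rw [hcdf]

lemma memLp_szaszSmoothing {Y : Ω → ℝ} (hY : Measurable Y) (m : ℕ) (x : ℝ) :
    MemLp (fun ω => szaszSmoothing m x (Y ω)) 2 P :=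
  MemLp.of_bound ((measurable_szaszSmoothing m x).comp hY).aestronglyMeasurable 1
    (ae_of_all _ fun _ => abs_szaszSmoothing_le m x _)

lemma memLp_szaszEstimator {X : ℕ → Ω → ℝ} (hmeas : ∀ i, Measurable (X i)) (m n : ℕ)
    (hx : 0 ≤ x) : MemLp (szaszEstimator X m n x) 2 P := by
  rw [funext (szaszEstimator_eq_sum X m n hx)]
  exact (memLp_finsetSum _ fun i _ => memLp_szaszSmoothing (hmeas i) m x).const_mul _

lemma integral_szaszEstimator {X : ℕ → Ω → ℝ} (hmeas : ∀ i, Measurable (X i)) {F : ℝ → ℝ}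
    (hcdf : ∀ i t, P.real {ω | X i ω ≤ t} = F t) (m : ℕ) {n : ℕ} (hn : 1 ≤ n) (hx : 0 ≤ x) :
    ∫ ω, szaszEstimator X m n x ω ∂P
      = ∫ k : ℕ, F ((k : ℝ) / m) ∂(poissonMeasure (szaszRate m x)) := by
  have hn' : (n : ℝ) ≠ 0 := by positivity
  simp_rw [szaszEstimator_eq_sum X m n hx]
  rw [integral_const_mul, integral_finsetSum _ fun i _ =>
    (memLp_szaszSmoothing (hmeas i) m x).integrable one_le_two]
  simp_rw [fun i => integral_szaszSmoothing (hmeas i) (hcdf i) m x]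
  simp [hn']

lemma variance_szaszEstimator {X : ℕ → Ω → ℝ} (hmeas : ∀ i, Measurable (X i))
    (hindep : iIndepFun X P) {F : ℝ → ℝ}
    (hcdf : ∀ i t, P.real {ω | X i ω ≤ t} = F t) (m : ℕ) {n : ℕ} (hn : 1 ≤ n) (hx : 0 ≤ x) :
    variance (szaszEstimator X m n x) P = (n : ℝ)⁻¹ *
      (∫ p : ℕ × ℕ, F (min (p.1 : ℝ) p.2 / m)
        ∂((poissonMeasure (szaszRate m x)).prod (poissonMeasure (szaszRate m x)))
      - (∫ k : ℕ, F ((k : ℝ) / m) ∂(poissonMeasure (szaszRate m x))) ^ 2) := by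
  have hn' : (n : ℝ) ≠ 0 := by positivity
  have hv : ∀ i, variance (fun ω => szaszSmoothing m x (X i ω)) P
      = ∫ p : ℕ × ℕ, F (min (p.1 : ℝ) p.2 / m)
        ∂((poissonMeasure (szaszRate m x)).prod (poissonMeasure (szaszRate m x)))
      - (∫ k : ℕ, F ((k : ℝ) / m) ∂(poissonMeasure (szaszRate m x))) ^ 2 := by
    intro i
    rw [variance_eq_sub (memLp_szaszSmoothing (hmeas i) m x),
      integral_szaszSmoothing (hmeas i) (hcdf i) m x,
      ← integral_szaszSmoothing_sq (hmeas i) (hcdf i) m x]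
    rfl
  have hsum : szaszEstimator X m n x = fun ω => (n : ℝ)⁻¹ *
      (∑ i ∈ Finset.range n, fun ω => szaszSmoothing m x (X i ω)) ω := by
    ext ω
    rw [szaszEstimator_eq_sum X m n hx, Finset.sum_apply]
  rw [hsum, variance_const_mul, IndepFun.variance_sum
    (fun i _ => memLp_szaszSmoothing (hmeas i) m x)
    (fun i _ j _ hij => (hindep.indepFun hij).comp (measurable_szaszSmoothing m x)
      (measurable_szaszSmoothing m x))]
  simp_rw [hv]
  rw [Finset.sum_const, Finset.card_range, nsmul_eq_mul]
  field_simp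

lemma meanSquaredError_eq_variance_add_sq {T : Ω → ℝ} (hT : MemLp T 2 P) (θ : ℝ) :
    meanSquaredError P T θ = variance T P + estimatorBias P T θ ^ 2 := by
  have hT1 : Integrable T P := hT.integrable one_le_two
  have h := variance_eq_sub (hT.sub (memLp_const θ))
  have h1 : variance (T - fun _ : Ω => θ) P = variance T P := variance_sub_const hT.1 θ
  have h2 : ∫ ω, (T - fun _ : Ω => θ) ω ∂P = estimatorBias P T θ := by
    rw [integral_sub' hT1 (integrable_const _)]
    simp [estimatorBias]
  rw [h1, h2] at h
  rw [h, sub_add_cancel]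
  rfl

end SzaszEstimator

/-! ### Assembly of the expansion -/

theorem mainTheorem5 {Ω : Type*} [MeasurableSpace Ω] (P : Measure Ω) [IsProbabilityMeasure P]
    (X : ℕ → Ω → ℝ) (F f df : ℝ → ℝ)
    (hmeas : ∀ i, Measurable (X i))
    (hindep : iIndepFun X P)
    (hcdf : ∀ i t, P.real {ω | X i ω ≤ t} = F t)
    (hF : SmoothHalfLineCDF F f df)
    (x : ℝ) (hx : 0 < x) :
    (∀ m n : ℕ, 1 ≤ m → 1 ≤ n →
      MemLp (szaszEstimator X m n x) 2 P ∧
      meanSquaredError P (szaszEstimator X m n x) (F x) =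
        variance (szaszEstimator X m n x) P +
          (estimatorBias P (szaszEstimator X m n x) (F x)) ^ 2) ∧
    ∃ e₁ e₂ : ℕ × ℕ → ℝ,
      (e₁ =o[(atTop : Filter ℕ) ×ˢ (atTop : Filter ℕ)]
        fun p => (p.1 : ℝ) ^ (-2 : ℝ)) ∧
      (e₂ =o[(atTop : Filter ℕ) ×ˢ (atTop : Filter ℕ)]
        fun p => (p.1 : ℝ) ^ (-(1 / 2) : ℝ) * (p.2 : ℝ)⁻¹) ∧
      ∀ m n : ℕ, 1 ≤ m → 1 ≤ n →
        meanSquaredError P (szaszEstimator X m n x) (F x) =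
          (n : ℝ)⁻¹ * sigmaSq F x
            - (m : ℝ) ^ (-(1 / 2) : ℝ) * (n : ℝ)⁻¹ * szaszV f x
            + (m : ℝ) ^ (-2 : ℝ) * (szaszB df x) ^ 2
            + e₁ (m, n) + e₂ (m, n) := by

  have hF1 : ∀ t, |F t| ≤ 1 := fun t => by
    rw [← hcdf 0 t, abs_of_nonneg measureReal_nonneg]
    exact measureReal_le_one
  have hmem := fun m n => memLp_szaszEstimator (P := P) hmeas m n hx.le
  have hmse := fun m n => meanSquaredError_eq_variance_add_sq (hmem m n) (F x)
  refine ⟨fun m n _ _ => ⟨hmem m n, hmse m n⟩, ?_⟩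
  obtain ⟨S, hS⟩ : ∃ S : ℕ → ℝ, S = fun m : ℕ =>
    ∫ k : ℕ, F ((k : ℝ) / m) ∂(poissonMeasure (szaszRate m x)) := ⟨_, rfl⟩
  obtain ⟨Q, hQ⟩ : ∃ Q : ℕ → ℝ, Q = fun m : ℕ =>
    ∫ p : ℕ × ℕ, F (min (p.1 : ℝ) p.2 / m)
      ∂((poissonMeasure (szaszRate m x)).prod (poissonMeasure (szaszRate m x))) := ⟨_, rfl⟩
  have hSlim : Tendsto (fun m : ℕ => (m : ℝ) * (S m - F x)) atTop (𝓝 (szaszB df x)) := by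
    rw [hS]; exact tendsto_mul_integral_szaszRate_sub hF hF1 hx
  have hQlim : Tendsto (fun m : ℕ => √(m : ℝ) * (Q m - F x)) atTop (𝓝 (-szaszV f x)) := by
    rw [hQ]; exact tendsto_sqrt_mul_integral_min_szaszRate_sub hF hF1 hx
  have hsqrt : ∀ m : ℕ, (m : ℝ) ^ (-(1 / 2) : ℝ) = (√(m : ℝ))⁻¹ := fun m => by
    rw [Real.rpow_neg m.cast_nonneg, ← Real.sqrt_eq_rpow]
  have hsq : ∀ m : ℕ, (m : ℝ) ^ (-2 : ℝ) = ((m : ℝ) ^ 2)⁻¹ := fun m => by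
    rw [Real.rpow_neg m.cast_nonneg, Real.rpow_two]
  have hSlim1 : Tendsto (fun m : ℕ => √(m : ℝ) * (S m - F x)) atTop (𝓝 0) := by
    have h := hSlim.mul (tendsto_inv_atTop_zero.comp
      (Real.tendsto_sqrt_atTop.comp tendsto_natCast_atTop_atTop))
    rw [mul_zero] at h
    refine h.congr' ?_
    filter_upwards [eventually_ge_atTop 1] with m hm
    have hm' : (0 : ℝ) < m := by exact_mod_cast hm
    have hs : √(m : ℝ) ≠ 0 := (Real.sqrt_pos.2 hm').ne'
    simp only [Function.comp_apply]
    rw [← div_eq_mul_inv, div_eq_iff hs]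
    linear_combination (-(S m - F x)) * Real.sq_sqrt hm'.le
  have hS0 : Tendsto (fun m : ℕ => S m + F x) atTop (𝓝 (F x + F x)) := by
    have h := hSlim.mul (tendsto_inv_atTop_zero.comp
      (tendsto_natCast_atTop_atTop (R := ℝ)))
    rw [mul_zero] at h
    have h' : Tendsto (fun m : ℕ => S m - F x) atTop (𝓝 0) := by
      refine h.congr' ?_
      filter_upwards [eventually_ge_atTop 1] with m hm
      have hm' : (m : ℝ) ≠ 0 := by positivity
      simp only [Function.comp_apply]
      field_simp
    simpa using h'.add_const (F x + F x)
  -- `e₁` is the error of the squared bias, `e₂` that of the variance. Apart from the exact factor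
  -- `1/n` in `e₂`, both depend on `m` alone, so the joint limit reduces to `m → ∞`.
  refine ⟨fun p => (S p.1 - F x) ^ 2 - (p.1 : ℝ) ^ (-2 : ℝ) * szaszB df x ^ 2,
    fun p => (p.2 : ℝ)⁻¹ * (Q p.1 - S p.1 ^ 2 - sigmaSq F x
      + (p.1 : ℝ) ^ (-(1 / 2) : ℝ) * szaszV f x), ?_, ?_, fun m n hm hn => ?_⟩
  · have h : (fun m : ℕ => (S m - F x) ^ 2 - (m : ℝ) ^ (-2 : ℝ) * szaszB df x ^ 2)
        =o[atTop] fun m : ℕ => (m : ℝ) ^ (-2 : ℝ) := by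
      refine (isLittleO_iff_tendsto' ?_).2 ?_
      · filter_upwards [eventually_ge_atTop 1] with m hm h0
        have hm' : (0 : ℝ) < m := by exact_mod_cast hm
        exact absurd h0 (Real.rpow_pos_of_pos hm' _).ne'
      · have h := (hSlim.pow 2).sub_const (szaszB df x ^ 2)
        rw [sub_self] at h
        refine h.congr' ?_
        filter_upwards [eventually_ge_atTop 1] with m hm
        have hm' : (m : ℝ) ≠ 0 := by positivity
        rw [hsq]
        field_simp
    exact h.comp_tendsto tendsto_fst
  · have h : (fun m : ℕ => Q m - S m ^ 2 - sigmaSq F x + (m : ℝ) ^ (-(1 / 2) : ℝ) * szaszV f x)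
        =o[atTop] fun m : ℕ => (m : ℝ) ^ (-(1 / 2) : ℝ) := by
      refine (isLittleO_iff_tendsto' ?_).2 ?_
      · filter_upwards [eventually_ge_atTop 1] with m hm h0
        have hm' : (0 : ℝ) < m := by exact_mod_cast hm
        exact absurd h0 (Real.rpow_pos_of_pos hm' _).ne'
      -- Uses `Q - S² - σ² = (Q - F) - (S - F)(S + F)`; the last product is `o(m^(-1/2))`.
      · have h := (hQlim.sub (hSlim1.mul hS0)).add_const (szaszV f x)
        rw [zero_mul, sub_zero, neg_add_cancel] at h
        refine h.congr' ?_
        filter_upwards [eventually_ge_atTop 1] with m hm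
        have hm' : (0 : ℝ) < m := by exact_mod_cast hm
        have hs : √(m : ℝ) ≠ 0 := (Real.sqrt_pos.2 hm').ne'
        rw [hsqrt, sigmaSq]
        field_simp
        ring
    have h2 := (isBigO_refl (fun p : ℕ × ℕ => (p.2 : ℝ)⁻¹) (atTop ×ˢ atTop)).mul_isLittleO
      (h.comp_tendsto (tendsto_fst (f := (atTop : Filter ℕ)) (g := (atTop : Filter ℕ))))
    refine h2.congr_right fun p => ?_
    exact mul_comm _ _
  · have hS' : estimatorBias P (szaszEstimator X m n x) (F x) = S m - F x := by
      rw [estimatorBias, integral_szaszEstimator hmeas hcdf m hn hx.le, hS]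
    have hV : variance (szaszEstimator X m n x) P = (n : ℝ)⁻¹ * (Q m - S m ^ 2) := by
      rw [variance_szaszEstimator hmeas hindep hcdf m hn hx.le, hQ, hS]
    rw [hmse, hS', hV]
    ring
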